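/- Let $L,T>0$, $I=[0,T]$, $\mathbb T=\mathbb R/L\mathbb Z$, and let $f:I\times\mathbb R\to\mathbb R$ be given by $f=-\partial_\phi U$ for a potential $U$ of the form $$U(t,\phi)=\sum_{j=0}^{2p_0}A_j(t)\phi^j+g(t,\phi),\qquad (t,\phi)\in I\times\mathbb R,$$ where $p_0\ge 1$ is an integer, $A_j\in C^1(I,\mathbb R)$ with $|A_j|$ and $|A_j'|$ bounded on $I$, $A_{2p_0}(t)>0$ for all $t\in I$, and $g\in C^2(I\times\mathbb R,\mathbb R)$ is such that $|g(t,\phi)\phi^{-1}|$ (for $\phi\ne0$), $|\partial_\phi g(t,\phi)|$, $|\partial_{\phi\phi}g(t,\phi)|$ and $|\partial_t g(t,\phi)|$ are bounded by a constant $M>0$ on $I\times\mathbb R$. Suppose that there are a continuous map $\phi^*:I\to\mathbb R$ and constants $a_+,a_->0$ such that for all $t\in I$ $$f(t,\phi^*(t))=0,\qquad -a_+\le\partial_\phi f(t,\phi^*(t))\le -a_-.$$ Let $(e_k)_{k\in\mathbb Z}$ be the orthonormal basis of $L^2(\mathbb T,\mathbb R)$ given by $e_k(x)=\sqrt{2/L}\cos(2\pi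 kx/L)$ for $k>0$, $e_0(x)=1/\sqrt L$, and $e_k(x)=\sqrt{2/L}\sin(2\pi kx/L)$ for $k<0$, and for $u=\sum_k u_ke_k$ put $\|u\|_{H^1}^2=\sum_{k\in\mathbb Z}(1+k^2)u_k^2$. Then there exist constants $C,\varepsilon_0>0$ such that for every $0<\varepsilon<\varepsilon_0$ the equation $$\varepsilon\,\partial_t\phi(t,x)=\Delta\phi(t,x)+f(t,\phi(t,x)),\qquad (t,x)\in I\times\mathbb T,$$ admits a classical solution $\bar\phi$ (that is, $\bar\phi,\partial_t\bar\phi,\partial_x\bar\phi,\partial_{xx}\bar\phi$ exist and are continuous on $I\times\mathbb T$, with one-sided time derivatives at the endpoints of $I$, and the equation holds at every point) satisfying $$\|\bar\phi(t,\cdot)-\phi^*(t)\|_{H^1}\le C\varepsilon\qquad\text{for all }t\in I,$$ where $\phi^*(t)$ also denotes the constant function on $\mathbb T$ with this value. -/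

import Mathlib

open Set

noncomputable section

/-- The real Fourier basis `e_k`, `k ∈ ℤ`, of `L²(ℝ/Lℤ)`, written as `L`-periodic functions
of a real variable. -/
def fourierMode (L : ℝ) (k : ℤ) (x : ℝ) : ℝ :=
  if 0 < k then Real.sqrt (2 / L) * Real.cos (2 * Real.pi * k * x / L)
  else if k = 0 then 1 / Real.sqrt L
  else Real.sqrt (2 / L) * Real.sin (2 * Real.pi * k * x / L)

/-- The Fourier coefficient `⟨u, e_k⟩` of a function on the torus `ℝ/Lℤ`. -/
def fourierModeCoeff (L : ℝ) (u : AddCircle L → ℝ) (k : ℤ) : ℝ :=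
  ∫ x in (0 : ℝ)..L, u (x : AddCircle L) * fourierMode L k x

/-- The Japanese bracket `⟨k⟩ = (1 + k²)^{1/2}`. -/
def japaneseBracket (k : ℤ) : ℝ := Real.sqrt (1 + (k : ℝ) ^ 2)

/-- The Sobolev norm `‖u‖_{H^s} = (∑_k ⟨k⟩^{2s} u_k²)^{1/2}`, with value `∞` when the series
diverges. -/
def sobolevNorm (L s : ℝ) (u : AddCircle L → ℝ) : ENNReal :=
  (∑' k : ℤ, ENNReal.ofReal (japaneseBracket k ^ (2 * s) * fourierModeCoeff L u k ^ 2)) ^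
    (1 / 2 : ℝ)

/-- Global behaviour of the potential `U` on `[0,T] × ℝ`: it is the sum of a polynomial in `φ` of
even degree `2 p₀ ≥ 2`, with `C¹` coefficients and positive leading coefficient, and of a `C²`
function `g` with `g(t,φ)/φ`, `∂_φ g`, `∂_φφ g` and `∂_t g` bounded. -/
def PotentialAssumption (T : ℝ) (U : ℝ → ℝ → ℝ) : Prop :=
  ∃ (p₀ : ℕ) (A : ℕ → ℝ → ℝ) (g : ℝ → ℝ → ℝ) (K M : ℝ),
    1 ≤ p₀ ∧ 0 < M ∧
    (∀ t ∈ Icc 0 T, ∀ φ : ℝ,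
      U t φ = (∑ j ∈ Finset.range (2 * p₀ + 1), A j t * φ ^ j) + g t φ) ∧
    (∀ j ≤ 2 * p₀, ContDiffOn ℝ 1 (A j) (Icc 0 T)) ∧
    (∀ j ≤ 2 * p₀, ∀ t ∈ Icc 0 T, |A j t| ≤ K ∧ |derivWithin (A j) (Icc 0 T) t| ≤ K) ∧
    (∀ t ∈ Icc 0 T, 0 < A (2 * p₀) t) ∧
    ContDiffOn ℝ 2 (fun p : ℝ × ℝ => g p.1 p.2) (Icc 0 T ×ˢ univ) ∧
    (∀ t ∈ Icc 0 T, ∀ φ : ℝ,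
      (φ ≠ 0 → |g t φ * φ⁻¹| ≤ M) ∧
      |deriv (g t) φ| ≤ M ∧
      |deriv (deriv (g t)) φ| ≤ M ∧
      |derivWithin (fun s => g s φ) (Icc 0 T) t| ≤ M)

/-- `φ` is a continuous stable equilibrium branch of `f`: `f(t, φ(t)) = 0` and
`-a₊ ≤ ∂_φ f(t, φ(t)) ≤ -a₋` on `[0,T]`, with `a₊, a₋ > 0`. -/
def IsStableBranch (T : ℝ) (f : ℝ → ℝ → ℝ) (φ : ℝ → ℝ) : Prop :=
  ContinuousOn φ (Icc 0 T) ∧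
  (∀ t ∈ Icc 0 T, f t (φ t) = 0) ∧
  ∃ aplus aminus : ℝ, 0 < aplus ∧ 0 < aminus ∧
    ∀ t ∈ Icc 0 T, -aplus ≤ deriv (f t) (φ t) ∧ deriv (f t) (φ t) ≤ -aminus

/-- `φ` is a classical solution of `ε ∂_t φ = Δφ + f(t, φ)` on `[0,T] × ℝ/Lℤ`: the derivatives
`∂_t φ`, `∂_x φ` and `∂_xx φ` exist (one-sided in time at `t = 0` and `t = T`), they and `φ` are
jointly continuous, and the equation holds pointwise. -/
def IsClassicalSolution (L T ε : ℝ) (f : ℝ → ℝ → ℝ) (φ : ℝ → AddCircle L → ℝ) : Prop :=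
  ∃ φt φx φxx : ℝ → AddCircle L → ℝ,
    ContinuousOn (fun p : ℝ × AddCircle L => φ p.1 p.2) (Icc 0 T ×ˢ univ) ∧
    ContinuousOn (fun p : ℝ × AddCircle L => φt p.1 p.2) (Icc 0 T ×ˢ univ) ∧
    ContinuousOn (fun p : ℝ × AddCircle L => φx p.1 p.2) (Icc 0 T ×ˢ univ) ∧
    ContinuousOn (fun p : ℝ × AddCircle L => φxx p.1 p.2) (Icc 0 T ×ˢ univ) ∧
    ∀ t ∈ Icc 0 T, ∀ x : ℝ,
      HasDerivWithinAt (fun s => φ s (x : AddCircle L)) (φt t x) (Icc 0 T) t ∧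
      HasDerivAt (fun y : ℝ => φ t (y : AddCircle L)) (φx t x) x ∧
      HasDerivAt (fun y : ℝ => φx t (y : AddCircle L)) (φxx t x) x ∧
      ε * φt t x = φxx t x + f t (φ t x)

end

open Filter Topology

/-! ### Sobolev norms of constants -/

/-! No initial condition is prescribed, so the solution may be taken constant in space: the
Laplacian vanishes and the equation becomes the slow-fast ODE `ε x' = f(t, x)`. On constants the
`H¹` norm is `√L` times the absolute value, so it suffices to find a trajectory of the ODE within
`O(ε)` of the branch.

That is a barrier argument. As `f` is `C¹` and `[0,T]` is compact, the stability bound at the branch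
spreads to a tube of uniform radius `r`, where `f` contracts at rate `a/2`. Contraction and the
Lipschitz bound in time make the branch Lipschitz, with constant `K'`. At distance `Cε` from the
branch the trajectory moves towards it at speed at least `(a/2)C`; once this exceeds `K'`, a
trajectory started on the branch cannot leave the tube of radius `Cε`. -/

theorem integral_fourierMode_of_ne_zero {L : ℝ} (hL : L ≠ 0) {k : ℤ} (hk : k ≠ 0) :
    ∫ x in (0 : ℝ)..L, fourierMode L k x = 0 := by
  have hk' : (k : ℝ) ≠ 0 := by exact_mod_cast hk
  have hc : 2 * Real.pi * k / L ≠ 0 := by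
    have := Real.pi_ne_zero
    positivity
  have harg : ∀ x : ℝ, 2 * Real.pi * k * x / L = (2 * Real.pi * k / L) * x := fun x => by ring
  have hcL : 2 * Real.pi * k / L * L = k * (2 * Real.pi) := by field_simp
  rcases lt_or_gt_of_ne hk with h | h
  · simp only [fourierMode, if_neg (not_lt.2 h.le), if_neg hk, harg,
      intervalIntegral.integral_const_mul]
    rw [intervalIntegral.integral_comp_mul_left (fun y => Real.sin y) hc, integral_sin, hcL,
      Real.cos_int_mul_two_pi]
    simp
  · simp only [fourierMode, if_pos h, harg, intervalIntegral.integral_const_mul]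
    rw [intervalIntegral.integral_comp_mul_left (fun y => Real.cos y) hc, integral_cos, hcL,
      show (k : ℝ) * (2 * Real.pi) = ((2 * k : ℤ) : ℝ) * Real.pi by push_cast; ring,
      Real.sin_int_mul_pi]
    simp

theorem fourierModeCoeff_const {L : ℝ} (hL : 0 < L) (c : ℝ) (k : ℤ) :
    fourierModeCoeff L (fun _ => c) k = if k = 0 then c * Real.sqrt L else 0 := by
  unfold fourierModeCoeff
  rw [intervalIntegral.integral_const_mul]
  split_ifs with hk
  · subst hk
    simp only [fourierMode, lt_irrefl, if_false, if_true, intervalIntegral.integral_const,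
      sub_zero, smul_eq_mul, mul_one_div, Real.div_sqrt]
  · rw [integral_fourierMode_of_ne_zero hL.ne' hk, mul_zero]

theorem sobolevNorm_const {L : ℝ} (hL : 0 < L) (s c : ℝ) :
    sobolevNorm L s (fun _ => c) = ENNReal.ofReal (|c| * Real.sqrt L) := by
  unfold sobolevNorm
  rw [tsum_eq_single 0 fun k hk => by simp [fourierModeCoeff_const hL, hk],
    fourierModeCoeff_const hL, if_pos rfl]
  have h1 : japaneseBracket 0 = 1 := by simp [japaneseBracket]
  rw [h1, Real.one_rpow, one_mul, ENNReal.ofReal_rpow_of_nonneg (by positivity) (by positivity),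
    ← Real.sqrt_eq_rpow, Real.sqrt_sq_eq_abs, abs_mul, abs_of_nonneg (Real.sqrt_nonneg L)]

/-! ### Regularity of the force -/

theorem uniqueDiffOn_Icc_prod_univ {T : ℝ} (hT : 0 < T) :
    UniqueDiffOn ℝ (Icc 0 T ×ˢ (univ : Set ℝ)) :=
  (uniqueDiffOn_Icc hT).prod uniqueDiffOn_univ

theorem hasDerivAt_snd_of_differentiableOn {s : Set ℝ} {F : ℝ → ℝ → ℝ}
    (hF : DifferentiableOn ℝ (fun p : ℝ × ℝ => F p.1 p.2) (s ×ˢ univ)) {t : ℝ} (ht : t ∈ s)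
    (φ : ℝ) :
    HasDerivAt (F t)
      (fderivWithin ℝ (fun p : ℝ × ℝ => F p.1 p.2) (s ×ˢ univ) (t, φ) (0, 1)) φ := by
  have h1 := (hF (t, φ) ⟨ht, mem_univ _⟩).hasFDerivWithinAt
  have h2 : HasDerivWithinAt (fun y : ℝ => ((t, y) : ℝ × ℝ)) (0, 1) univ φ :=
    (hasDerivWithinAt_const φ univ t).prodMk (hasDerivWithinAt_id φ univ)
  exact (h1.comp_hasDerivWithinAt φ h2 fun y _ => ⟨ht, mem_univ _⟩).hasDerivAt univ_mem

/-- Differentiating `U` in `φ` costs `g` one of its two derivatives, and the polynomial part is only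
`C¹` in time, whence the order 1. -/
theorem contDiffOn_force {T : ℝ} (hT : 0 < T) {U f : ℝ → ℝ → ℝ} (hU : PotentialAssumption T U)
    (hf : ∀ t ∈ Icc 0 T, ∀ φ : ℝ, HasDerivAt (U t) (-f t φ) φ) :
    ContDiffOn ℝ 1 (fun p : ℝ × ℝ => f p.1 p.2) (Icc 0 T ×ˢ univ) := by
  obtain ⟨p₀, A, g, K, M, -, -, hUeq, hA, -, -, hg, -⟩ := hU
  set S : Set (ℝ × ℝ) := Icc 0 T ×ˢ univ
  have hD : ContDiffOn ℝ 1 (fun p : ℝ × ℝ =>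
      fderivWithin ℝ (fun p : ℝ × ℝ => g p.1 p.2) S p (0, 1)) S :=
    (hg.fderivWithin (uniqueDiffOn_Icc_prod_univ hT) (m := 1) (by norm_num)).clm_apply
      contDiffOn_const
  have hP : ContDiffOn ℝ 1 (fun p : ℝ × ℝ =>
      ∑ j ∈ Finset.range (2 * p₀ + 1), A j p.1 * (j * p.2 ^ (j - 1))) S := by
    refine ContDiffOn.sum fun j hj => ?_
    have hj' : j ≤ 2 * p₀ := Nat.lt_succ_iff.1 (Finset.mem_range.1 hj)
    exact ((hA j hj').comp contDiff_fst.contDiffOn fun p hp => hp.1).mul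
      (contDiff_const.mul (contDiff_snd.pow _)).contDiffOn
  refine (hP.add hD).neg.congr fun p hp => ?_
  obtain ⟨t, φ⟩ := p
  have ht : t ∈ Icc 0 T := hp.1
  have h1 : HasDerivAt (fun φ : ℝ => ∑ j ∈ Finset.range (2 * p₀ + 1), A j t * φ ^ j)
      (∑ j ∈ Finset.range (2 * p₀ + 1), A j t * (j * φ ^ (j - 1))) φ :=
    HasDerivAt.fun_sum fun j _ => (hasDerivAt_pow j φ).const_mul (A j t)
  have h2 := h1.add
    (hasDerivAt_snd_of_differentiableOn (F := g) (hg.differentiableOn (by norm_num)) ht φ)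
  have h3 : U t = (fun φ : ℝ => ∑ j ∈ Finset.range (2 * p₀ + 1), A j t * φ ^ j) + g t :=
    funext fun y => hUeq t ht y
  have h4 := hf t ht φ
  rw [h3] at h4
  have := h4.unique h2
  linarith

/-! ### Slow-fast ordinary differential equations -/

/-- A `C¹` function on a compact convex set is Lipschitz. -/
theorem exists_lipschitzOnWith_Icc_prod {T : ℝ} (hT : 0 < T) {F : ℝ → ℝ → ℝ}
    (hF : ContDiffOn ℝ 1 (fun p : ℝ × ℝ => F p.1 p.2) (Icc 0 T ×ˢ univ)) (B : ℝ) :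
    ∃ K, LipschitzOnWith K (fun p : ℝ × ℝ => F p.1 p.2) (Icc 0 T ×ˢ Icc (-B) B) := by
  have hsub : Icc 0 T ×ˢ Icc (-B) B ⊆ (Icc 0 T ×ˢ univ : Set (ℝ × ℝ)) :=
    prod_mono subset_rfl (subset_univ _)
  have hcont := (hF.continuousOn_fderivWithin (uniqueDiffOn_Icc_prod_univ hT) le_rfl).mono hsub
  obtain ⟨K, hK⟩ := (isCompact_Icc.prod isCompact_Icc).exists_bound_of_continuousOn hcont
  refine ⟨K.toNNReal, Convex.lipschitzOnWith_of_nnnorm_hasFDerivWithin_le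
    (f' := fderivWithin ℝ (fun p : ℝ × ℝ => F p.1 p.2) (Icc 0 T ×ˢ univ))
    (fun p hp => ?_) (fun p hp => ?_) ((convex_Icc 0 T).prod (convex_Icc _ _))⟩
  · exact ((hF.differentiableOn (by norm_num)) p (hsub hp)).hasFDerivWithinAt.mono hsub
  · exact NNReal.le_toNNReal_of_coe_le (hK p hp)

/-- Near a stable branch the force is uniformly contracting. -/
theorem exists_uniform_contraction {T : ℝ} (hT : 0 < T) {f : ℝ → ℝ → ℝ} {ψ : ℝ → ℝ} {a : ℝ}
    (ha : 0 < a) (hfC : ContDiffOn ℝ 1 (fun p : ℝ × ℝ => f p.1 p.2) (Icc 0 T ×ˢ univ))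
    (hψ : ContinuousOn ψ (Icc 0 T)) (hstab : ∀ t ∈ Icc 0 T, deriv (f t) (ψ t) ≤ -a) :
    ∃ r > 0, ∀ t ∈ Icc 0 T, ∀ x ∈ Icc (ψ t - r) (ψ t + r), ∀ y ∈ Icc (ψ t - r) (ψ t + r),
      x ≤ y → f t y - f t x ≤ -(a / 2) * (y - x) := by
  set D : ℝ × ℝ → ℝ := fun p =>
    fderivWithin ℝ (fun p : ℝ × ℝ => f p.1 p.2) (Icc 0 T ×ˢ univ) p (0, 1) with hDdef
  have hderiv : ∀ t ∈ Icc 0 T, ∀ φ, HasDerivAt (f t) (D (t, φ)) φ := fun t ht φ =>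
    hasDerivAt_snd_of_differentiableOn (hfC.differentiableOn (by norm_num)) ht φ
  have hDc : ContinuousOn D (Icc 0 T ×ˢ univ) :=
    (hfC.continuousOn_fderivWithin (uniqueDiffOn_Icc_prod_univ hT) le_rfl).clm_apply
      continuousOn_const
  -- Recentring at the branch puts the problem on a compact rectangle, so uniform continuity yields
  -- a radius independent of `t`.
  have hE : ContinuousOn (fun p : ℝ × ℝ => D (p.1, ψ p.1 + p.2)) (Icc 0 T ×ˢ Icc (-1) 1) := by
    refine hDc.comp (continuousOn_fst.prodMk ?_) fun p hp => ⟨hp.1, mem_univ _⟩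
    exact (hψ.comp continuousOn_fst fun p hp => hp.1).add continuousOn_snd
  have huc := (isCompact_Icc.prod isCompact_Icc).uniformContinuousOn_of_continuous hE
  obtain ⟨δ, hδ, H⟩ := Metric.uniformContinuousOn_iff.1 huc (a / 2) (by positivity)
  refine ⟨min (δ / 2) 1, by positivity, fun t ht x hx y hy hxy => ?_⟩
  set r := min (δ / 2) 1
  have hr1 : r ≤ 1 := min_le_right _ _
  have hr2 : r ≤ δ / 2 := min_le_left _ _
  refine Convex.image_sub_le_mul_sub_of_deriv_le (convex_Icc (ψ t - r) (ψ t + r))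
    (fun z _ => (hderiv t ht z).continuousAt.continuousWithinAt)
    (fun z _ => (hderiv t ht z).differentiableAt.differentiableWithinAt)
    (fun z hz => ?_) x hx y hy hxy
  rw [interior_Icc] at hz
  rw [(hderiv t ht z).deriv]
  have h0 := hstab t ht
  rw [(hderiv t ht _).deriv] at h0
  have hz' : |z - ψ t| < r := abs_lt.2 ⟨by linarith [hz.1], by linarith [hz.2]⟩
  have h1 := H (t, z - ψ t) ⟨ht, abs_le.1 (hz'.le.trans hr1)⟩ (t, 0) ⟨ht, by norm_num⟩ (by
    rw [Prod.dist_eq, dist_self, Real.dist_eq]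
    simp only [sub_zero]
    exact max_lt hδ (by linarith))
  simp only [add_sub_cancel, add_zero, Real.dist_eq] at h1
  linarith [(abs_lt.1 h1).2]

/-- A continuous function on `[0,T]` which is Lipschitz at small distances is Lipschitz. -/
theorem exists_lipschitz_of_local {T : ℝ} {ψ : ℝ → ℝ} (hψ : ContinuousOn ψ (Icc 0 T))
    {δ K : ℝ} (hδ : 0 < δ)
    (h : ∀ s ∈ Icc 0 T, ∀ t ∈ Icc 0 T, |t - s| < δ → |ψ t - ψ s| ≤ K * |t - s|) :
    ∃ K' > 0, ∀ s ∈ Icc 0 T, ∀ t ∈ Icc 0 T, |ψ t - ψ s| ≤ K' * |t - s| := by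
  obtain ⟨B, hB⟩ := isCompact_Icc.exists_bound_of_continuousOn hψ
  refine ⟨max (max K (2 * B / δ)) 1, by positivity, fun s hs t ht => ?_⟩
  have h1 : max K (2 * B / δ) ≤ max (max K (2 * B / δ)) 1 := le_max_left _ _
  rcases lt_or_ge |t - s| δ with hlt | hge
  · exact (h s hs t ht hlt).trans
      (mul_le_mul_of_nonneg_right ((le_max_left _ _).trans h1) (abs_nonneg _))
  · have hBt := hB t ht
    have hBs := hB s hs
    rw [Real.norm_eq_abs] at hBt hBs
    have hB0 : 0 ≤ B := (abs_nonneg _).trans hBt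
    calc |ψ t - ψ s| ≤ |ψ t| + |ψ s| := abs_sub _ _
      _ ≤ 2 * B / δ * δ := by field_simp; linarith
      _ ≤ 2 * B / δ * |t - s| := by gcongr
      _ ≤ _ := mul_le_mul_of_nonneg_right ((le_max_right _ _).trans h1) (abs_nonneg _)

/-- A quantitative implicit function argument: for nearby times, `a |ψ t - ψ s| ≤ |f t (ψ s)| = |f t
(ψ s) - f s (ψ s)| ≤ K |t - s|`. -/
theorem exists_lipschitz_stable_branch {T : ℝ} {f : ℝ → ℝ → ℝ}
    {ψ : ℝ → ℝ} {a r B : ℝ} {K : NNReal} (ha : 0 < a) (hr : 0 < r)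
    (hψ : ContinuousOn ψ (Icc 0 T)) (hzero : ∀ t ∈ Icc 0 T, f t (ψ t) = 0)
    (hB : ∀ t ∈ Icc 0 T, |ψ t| ≤ B)
    (hK : LipschitzOnWith K (fun p : ℝ × ℝ => f p.1 p.2) (Icc 0 T ×ˢ Icc (-B) B))
    (hcontr : ∀ t ∈ Icc 0 T, ∀ x ∈ Icc (ψ t - r) (ψ t + r), ∀ y ∈ Icc (ψ t - r) (ψ t + r),
      x ≤ y → f t y - f t x ≤ -a * (y - x)) :
    ∃ K' > 0, ∀ s ∈ Icc 0 T, ∀ t ∈ Icc 0 T, |ψ t - ψ s| ≤ K' * |t - s| := by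
  obtain ⟨δ, hδ, H⟩ := Metric.uniformContinuousOn_iff.1
    (isCompact_Icc.uniformContinuousOn_of_continuous hψ) r hr
  refine exists_lipschitz_of_local hψ (K := K / a) hδ fun s hs t ht hst => ?_
  have hd : |ψ t - ψ s| < r := H t ht s hs hst
  obtain ⟨hd1, hd2⟩ := abs_lt.1 hd
  have hlip := hK.dist_le_mul (t, ψ s) ⟨ht, abs_le.1 (hB s hs)⟩ (s, ψ s) ⟨hs, abs_le.1 (hB s hs)⟩
  rw [Prod.dist_eq, dist_self, max_eq_left dist_nonneg, Real.dist_eq, Real.dist_eq] at hlip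
  simp only [hzero s hs, sub_zero] at hlip
  have h0 := hzero t ht
  have key : a * |ψ t - ψ s| ≤ |f t (ψ s)| := by
    rcases le_total (ψ s) (ψ t) with h | h
    · have := hcontr t ht (ψ s) ⟨by linarith, by linarith⟩ (ψ t) ⟨by linarith, by linarith⟩ h
      rw [abs_of_nonneg (sub_nonneg.2 h)]
      linarith [le_abs_self (f t (ψ s))]
    · have := hcontr t ht (ψ t) ⟨by linarith, by linarith⟩ (ψ s) ⟨by linarith, by linarith⟩ h
      rw [abs_of_nonpos (sub_nonpos.2 h)]
      linarith [neg_abs_le (f t (ψ s))]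
  rw [div_mul_eq_mul_div, le_div_iff₀ ha]
  linarith

/-- A function whose derivative beats the Lipschitz constant of `ψ` on `ψ + c` never crosses
`ψ + c` upwards. -/
theorem le_add_const_of_deriv_lt {T K c : ℝ} {x x' ψ : ℝ → ℝ}
    (hx : ∀ t ∈ Icc 0 T, HasDerivWithinAt x (x' t) (Icc 0 T) t)
    (hψ : ContinuousOn ψ (Icc 0 T))
    (hK : ∀ s ∈ Icc 0 T, ∀ t ∈ Icc 0 T, |ψ t - ψ s| ≤ K * |t - s|)
    (h0 : x 0 ≤ ψ 0 + c) (hlt : ∀ t ∈ Icc 0 T, x t = ψ t + c → x' t < -K) :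
    ∀ t ∈ Icc 0 T, x t ≤ ψ t + c := by
  have hxc : ContinuousOn x (Icc 0 T) := fun t ht => (hx t ht).continuousWithinAt
  -- `ψ` need not be differentiable; `x' + K` still bounds the right slopes of `x - ψ` from above,
  -- which is all this comparison needs.
  have := image_le_of_liminf_slope_right_lt_deriv_boundary' (f := fun t => x t - ψ t)
    (f' := fun t => x' t + K) (a := 0) (b := T) (B := fun _ => c) (B' := fun _ => 0)
    (hxc.sub hψ) (fun t ht r hr => ?_) (by linarith) continuousOn_const
    (fun t _ => hasDerivWithinAt_const _ _ _)
    (fun t ht h => by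
      have := hlt t (Ico_subset_Icc_self ht) (by linarith)
      linarith)
  · intro t ht
    have := this ht
    linarith
  · have ht' := Ico_subset_Icc_self ht
    have hd : HasDerivWithinAt x (x' t) (Ioi t) t :=
      (hx t ht').mono_of_mem_nhdsWithin
        (mem_of_superset (Ioo_mem_nhdsGT ht.2) fun z hz => ⟨ht.1.trans hz.1.le, hz.2.le⟩)
    have hs := (hasDerivWithinAt_iff_tendsto_slope' (notMem_Ioi.2 le_rfl)).1 hd
    have hev := hs.eventually (gt_mem_nhds (show x' t < r - K by linarith))
    refine Eventually.frequently ?_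
    filter_upwards [hev, Ioo_mem_nhdsGT ht.2] with z hz1 hz2
    have hpos : 0 < z - t := sub_pos.2 hz2.1
    have hk := hK t ht' z ⟨ht.1.trans hz2.1.le, hz2.2.le⟩
    rw [abs_of_pos hpos] at hk
    rw [slope_def_field, div_lt_iff₀ hpos] at hz1 ⊢
    nlinarith [neg_abs_le (ψ z - ψ t)]

/-- Global existence on `[0,T]` for vector fields that are Lipschitz on `[0,T] × [-B,B]`, truncated
outside `[-B,B]`. -/
theorem exists_solution_truncated {T B ε : ℝ} (hT : 0 ≤ T) (hB : 0 ≤ B) {f : ℝ → ℝ → ℝ} {K : NNReal}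
    (hε : 0 < ε)
    (hK : LipschitzOnWith K (fun p : ℝ × ℝ => f p.1 p.2) (Icc 0 T ×ˢ Icc (-B) B)) (x₀ : ℝ) :
    ∃ x : ℝ → ℝ, x 0 = x₀ ∧ ∀ t ∈ Icc 0 T,
      HasDerivWithinAt x (f t (max (-B) (min B (x t))) / ε) (Icc 0 T) t := by
  have hmem : ∀ y : ℝ, max (-B) (min B y) ∈ Icc (-B) B := fun y =>
    ⟨le_max_left _ _, max_le (by linarith) (min_le_left _ _)⟩
  have hclamp : LipschitzWith 1 fun y : ℝ => max (-B) (min B y) :=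
    (LipschitzWith.id.const_min B).const_max (-B)
  obtain ⟨N, hN⟩ := (isCompact_Icc.prod isCompact_Icc).exists_bound_of_continuousOn hK.continuousOn
  have hεn : ‖ε⁻¹‖ = ε⁻¹ := Real.norm_of_nonneg (by positivity)
  set N' : NNReal := (ε⁻¹ * N).toNNReal
  -- The truncated field has speed at most `N'`, so a ball of radius `N' * T` contains the solution
  -- over the whole of `[0,T]`.
  have hPL : IsPicardLindelof (fun t y => f t (max (-B) (min B y)) / ε)
      (⟨0, left_mem_Icc.2 hT⟩ : Icc 0 T) x₀ (N' * T.toNNReal) 0 N' (‖ε⁻¹‖₊ * K) := by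
    refine ⟨fun t ht => LipschitzWith.lipschitzOnWith ?_, fun y _ => ?_, fun t ht y _ => ?_, ?_⟩
    · refine LipschitzWith.of_dist_le_mul fun y z => ?_
      have h1 := hK.dist_le_mul (t, max (-B) (min B y)) ⟨ht, hmem y⟩
        (t, max (-B) (min B z)) ⟨ht, hmem z⟩
      rw [Prod.dist_eq, dist_self, max_eq_right dist_nonneg] at h1
      have h2 := hclamp.dist_le_mul y z
      simp only [NNReal.coe_one, one_mul] at h2
      rw [Real.dist_eq] at h1 ⊢
      rw [← sub_div, abs_div, abs_of_pos hε, NNReal.coe_mul, coe_nnnorm, hεn, div_eq_inv_mul,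
        mul_assoc]
      gcongr
      exact h1.trans (by gcongr)
    · exact (hK.continuousOn.comp (continuousOn_id.prodMk continuousOn_const)
        fun t ht => ⟨ht, hmem y⟩).div_const ε
    · have := hN (t, max (-B) (min B y)) ⟨ht, hmem y⟩
      rw [norm_div, Real.norm_of_nonneg hε.le, div_eq_inv_mul]
      refine le_trans ?_ (Real.le_coe_toNNReal _)
      gcongr
    · simp [Real.coe_toNNReal _ hT, hT]
  exact hPL.exists_eq_forall_mem_Icc_hasDerivWithinAt₀

/-- Tracking of a stable branch by a solution of a slow-fast ordinary differential equation. -/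
theorem exists_tracking_solution {T : ℝ} (hT : 0 < T) {f : ℝ → ℝ → ℝ} {ψ : ℝ → ℝ}
    (hfC : ContDiffOn ℝ 1 (fun p : ℝ × ℝ => f p.1 p.2) (Icc 0 T ×ˢ univ))
    (hstar : IsStableBranch T f ψ) :
    ∃ C ε₀ : ℝ, 0 < C ∧ 0 < ε₀ ∧ ∀ ε : ℝ, 0 < ε → ε < ε₀ → ∃ x : ℝ → ℝ,
      (∀ t ∈ Icc 0 T, HasDerivWithinAt x (f t (x t) / ε) (Icc 0 T) t) ∧
      ∀ t ∈ Icc 0 T, |x t - ψ t| ≤ C * ε := by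
  obtain ⟨hψ, hzero, _, a, -, ha, hstab⟩ := hstar
  obtain ⟨r, hr, hcontr⟩ := exists_uniform_contraction hT ha hfC hψ fun t ht => (hstab t ht).2
  obtain ⟨B₀, hB₀⟩ := isCompact_Icc.exists_bound_of_continuousOn hψ
  simp only [Real.norm_eq_abs] at hB₀
  have h0T : (0 : ℝ) ∈ Icc 0 T := left_mem_Icc.2 hT.le
  have hB₀0 : 0 ≤ B₀ := (abs_nonneg _).trans (hB₀ 0 h0T)
  -- The box contains the whole tube of radius `r`, so truncation changes nothing there.
  obtain ⟨K, hK⟩ := exists_lipschitzOnWith_Icc_prod hT hfC (B₀ + r)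
  obtain ⟨K', hK'0, hK'⟩ := exists_lipschitz_stable_branch (half_pos ha) hr hψ hzero
    (fun t ht => (hB₀ t ht).trans (by linarith)) hK hcontr
  have hC : 0 < 2 * K' / a + 1 := by positivity
  -- With this `C`, `(a/2)C = K' + a/2 > K'`; the choice of `ε₀` gives `Cε < r`.
  refine ⟨2 * K' / a + 1, r / (2 * K' / a + 1), hC, by positivity, fun ε hε hεlt => ?_⟩
  set C := 2 * K' / a + 1 with hCdef
  have hCK : K' < a / 2 * C := by
    rw [hCdef]; field_simp; linarith
  have hCε : C * ε < r := by
    rw [lt_div_iff₀ hC] at hεlt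
    linarith
  have hCε0 : 0 < C * ε := by positivity
  obtain ⟨x, hx0, hx⟩ := exists_solution_truncated hT.le (by linarith) hε hK (ψ 0)
  have hclamp : ∀ t ∈ Icc 0 T, ∀ y, |y - ψ t| ≤ r →
      max (-(B₀ + r)) (min (B₀ + r) y) = y := fun t ht y hy => by
    have h1 := abs_le.1 (hB₀ t ht)
    have h2 := abs_le.1 hy
    rw [min_eq_right (by linarith), max_eq_right (by linarith)]
  have hrate : ∀ {z : ℝ}, z ≤ -(a / 2) * (C * ε) → z / ε < -K' := fun {z} hz => by
    rw [div_lt_iff₀ hε]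
    nlinarith
  have hup : ∀ t ∈ Icc 0 T, x t ≤ ψ t + C * ε := by
    refine le_add_const_of_deriv_lt hx hψ hK' (by linarith) fun t ht hxt => hrate ?_
    rw [hclamp t ht (x t) (by rw [hxt, add_sub_cancel_left, abs_of_pos hCε0]; exact hCε.le), hxt]
    have := hcontr t ht (ψ t) ⟨by linarith, by linarith⟩ (ψ t + C * ε)
      ⟨by linarith, by linarith⟩ (by linarith)
    rw [hzero t ht] at this
    linarith
  -- The lower barrier is the upper one for `-x` and `-ψ`.
  have hlow : ∀ t ∈ Icc 0 T, -x t ≤ -ψ t + C * ε := by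
    refine le_add_const_of_deriv_lt (K := K') (ψ := fun t => -ψ t) (fun t ht => (hx t ht).fun_neg)
      hψ.fun_neg (fun s hs t ht => ?_) (by linarith) fun t ht hxt => ?_
    · rw [neg_sub_neg, abs_sub_comm]
      exact hK' s hs t ht
    · have hxt' : x t = ψ t - C * ε := by linarith
      rw [← neg_div]
      refine hrate ?_
      rw [hclamp t ht (x t) (by
        rw [hxt', sub_sub_cancel_left, abs_neg, abs_of_pos hCε0]; exact hCε.le), hxt']
      have := hcontr t ht (ψ t - C * ε) ⟨by linarith, by linarith⟩ (ψ t)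
        ⟨by linarith, by linarith⟩ (by linarith)
      rw [hzero t ht] at this
      linarith
  have hclose : ∀ t ∈ Icc 0 T, |x t - ψ t| ≤ C * ε := fun t ht =>
    abs_le.2 ⟨by linarith [hlow t ht], by linarith [hup t ht]⟩
  refine ⟨x, fun t ht => ?_, hclose⟩
  have := hx t ht
  rwa [hclamp t ht _ ((hclose t ht).trans hCε.le)] at this

/-- A solution of the ordinary differential equation is a space-homogeneous classical solution. -/
theorem isClassicalSolution_of_homogeneous (L : ℝ) {T ε : ℝ} (hε : ε ≠ 0) {f : ℝ → ℝ → ℝ}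
    {x : ℝ → ℝ} (hf : ContinuousOn (fun p : ℝ × ℝ => f p.1 p.2) (Icc 0 T ×ˢ univ))
    (hx : ∀ t ∈ Icc 0 T, HasDerivWithinAt x (f t (x t) / ε) (Icc 0 T) t) :
    IsClassicalSolution L T ε f fun t _ => x t := by
  have hxc : ContinuousOn x (Icc 0 T) := fun t ht => (hx t ht).continuousWithinAt
  have hfc : ContinuousOn (fun t => f t (x t) / ε) (Icc 0 T) :=
    (hf.comp (continuousOn_id.prodMk hxc) fun t ht => ⟨ht, mem_univ _⟩).div_const ε
  refine ⟨fun t _ => f t (x t) / ε, fun _ _ => 0, fun _ _ => 0,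
    hxc.comp continuousOn_fst fun p hp => hp.1, hfc.comp continuousOn_fst fun p hp => hp.1,
    continuousOn_const, continuousOn_const, fun t ht y => ⟨hx t ht, hasDerivAt_const _ _,
      hasDerivAt_const _ _, ?_⟩⟩
  field_simp
  ring


theorem mainTheorem6 (L T : ℝ) (hL : 0 < L) (hT : 0 < T)
    (U f : ℝ → ℝ → ℝ) (hU : PotentialAssumption T U)
    (hf : ∀ t ∈ Set.Icc 0 T, ∀ φ : ℝ, HasDerivAt (U t) (-f t φ) φ)
    (φstar : ℝ → ℝ) (hstar : IsStableBranch T f φstar) :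
    ∃ C ε₀ : ℝ, 0 < C ∧ 0 < ε₀ ∧
      ∀ ε : ℝ, 0 < ε → ε < ε₀ →
        ∃ φbar : ℝ → AddCircle L → ℝ,
          IsClassicalSolution L T ε f φbar ∧
          ∀ t ∈ Set.Icc 0 T,
            sobolevNorm L 1 (fun x => φbar t x - φstar t) ≤ ENNReal.ofReal (C * ε) := by
  have hfC := contDiffOn_force hT hU hf
  obtain ⟨C, ε₀, hC, hε₀, H⟩ := exists_tracking_solution hT hfC hstar
  refine ⟨C * Real.sqrt L, ε₀, by positivity, hε₀, fun ε hε hεlt => ?_⟩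
  obtain ⟨x, hx, hclose⟩ := H ε hε hεlt
  refine ⟨fun t _ => x t,
    isClassicalSolution_of_homogeneous L hε.ne' hfC.continuousOn hx, fun t ht => ?_⟩
  rw [sobolevNorm_const hL]
  refine ENNReal.ofReal_le_ofReal ?_
  calc |x t - φstar t| * Real.sqrt L ≤ C * ε * Real.sqrt L := by gcongr; exact hclose t ht
    _ = C * Real.sqrt L * ε := by ring
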